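/- **Theorem 1.1.** Let $M$ be a nonempty finite-dimensional $C^\infty$ manifold that is Hausdorff, paracompact and without boundary, let $1\le r\le\infty$, and let $\mathrm{Diff}^r_c(M)_0$ be the group of $C^r$ diffeomorphisms of $M$ that can be joined to $\mathrm{id}_M$ by a compactly supported $C^r$ isotopy. Let $G\le \mathrm{Diff}^r_c(M)_0$ be a subgroup that is * *isotopically connected*: every $g\in G$ can be joined to $\mathrm{id}_M$ through a $C^r$ isotopy in $G$, that is, there is a $C^r$ map $\mathbb R\times M\to M$, $(t,x)\mapsto f_t(x)$, with $f_t\in G$ for all $t$, $f_0=\mathrm{id}_M$ and $f_1=g$; * *non-fixing*: $G(x)\ne\{x\}$ for every $x\in M$; * *factorizable*: for every open cover $\mathcal U$ of $M$, every $g\in G$ is a finite product $g=g_1\cdots g_k$ with $g_i\in G_{U_i}$ for some $U_i\in\mathcal U$, where $G_U$ is the identity component of the group of those elements of $G$ that have compact support contained in $U$ (the elements that can be joined to $\mathrm{id}_M$ through a $C^r$ isotopy in this group). Let $\mathcal F_{[G,G]}$ be the singular foliation determined by the commutator subgroup $[G,G]$; its leaves are the accessible sets of the set of all $C^r$-arrows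 obtained by restricting isotopies in $[G,G]$ starting at $\mathrm{id}_M$ to open subsets of $\mathbb R\times M$. Then $[G,G]$ is a simple group if and only if all leaves of $\mathcal F_{[G,G]}$ are dense in $M$. Call a set *minimal* if it is minimal under inclusion among the nonempty closed unions of leaves, and *proper* if it is not equal to $M$. If $[G,G]$ is simple, then $\mathcal F_{[G,G]}$ has no proper minimal set. If $M$ is compact, then $[G,G]$ is simple if and only if $\mathcal F_{[G,G]}$ has no proper minimal set. -/

import Mathlib

open scoped Manifold ContDiff

/-- The group of `C^n` diffeomorphisms of `M`, with composition as multiplication. -/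
instance Diffeomorph.instGroupSelf {𝕜 : Type*} [NontriviallyNormedField 𝕜]
    {E : Type*} [NormedAddCommGroup E] [NormedSpace 𝕜 E] {H : Type*} [TopologicalSpace H]
    {I : ModelWithCorners 𝕜 E H} {M : Type*} [TopologicalSpace M] [ChartedSpace H M]
    {n : WithTop ℕ∞} : Group (Diffeomorph I I M M n) where
  mul f g := g.trans f
  one := Diffeomorph.refl I M n
  inv f := f.symm
  mul_assoc _ _ _ := rfl
  one_mul _ := rfl
  mul_one _ := rfl
  inv_mul_cancel f := f.self_trans_symm

namespace DiffGroups

/-- `Diff^r(M)` for an `m`-dimensional manifold `M`. -/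
abbrev Diff (m : ℕ) (r : ℕ∞) (M : Type*) [TopologicalSpace M]
    [ChartedSpace (EuclideanSpace ℝ (Fin m)) M] : Type _ :=
  Diffeomorph (𝓡 m) (𝓡 m) M M (r : WithTop ℕ∞)

variable {m : ℕ} {r : ℕ∞} {M : Type*} [TopologicalSpace M]
  [ChartedSpace (EuclideanSpace ℝ (Fin m)) M]

/-- A `C^r` isotopy starting at the identity: a family `f t`, `t ∈ ℝ`, of diffeomorphisms such that
`(t, x) ↦ f t x` is of class `C^r` and `f 0 = id`. -/
def IsIsotopy (f : ℝ → Diff m r M) : Prop :=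
  ContMDiff (𝓘(ℝ, ℝ).prod (𝓡 m)) (𝓡 m) (r : WithTop ℕ∞) (fun p : ℝ × M => f p.1 p.2) ∧ f 0 = 1

/-- The diffeomorphisms that can be joined to the identity by a `C^r` isotopy all of whose members
lie in `S`. If `S` is a group of diffeomorphisms, this is its identity component. -/
def identityComponent (S : Set (Diff m r M)) : Set (Diff m r M) :=
  {g | ∃ f : ℝ → Diff m r M, IsIsotopy f ∧ (∀ t, f t ∈ S) ∧ f 1 = g}

/-- Every element of `G` is joined to the identity by a `C^r` isotopy in `G`. -/
def IsotopicallyConnected (G : Subgroup (Diff m r M)) : Prop :=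
  ∀ g ∈ G, g ∈ identityComponent (G : Set (Diff m r M))

variable (m r M) in
/-- `Diff^r_c(M)_0`: the diffeomorphisms that can be joined to the identity by a compactly supported
`C^r` isotopy, that is, one which from time `0` to time `1` moves no point outside some compact
set. -/
def diffCompactZero : Set (Diff m r M) :=
  {g | ∃ f : ℝ → Diff m r M, IsIsotopy f ∧ f 1 = g ∧
    ∃ K : Set M, IsCompact K ∧ ∀ t ∈ Set.Icc (0 : ℝ) 1, ∀ x, x ∉ K → f t x = x}

/-- The support of a diffeomorphism. -/
def supp (g : Diff m r M) : Set M := closure {x | g x ≠ x}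

/-- The elements of `G` that are compactly supported in `U`. -/
def supportedIn (G : Subgroup (Diff m r M)) (U : Set M) : Set (Diff m r M) :=
  {g | g ∈ G ∧ IsCompact (supp g) ∧ supp g ⊆ U}

/-- For every open cover, each element of `G` is a finite product of elements, each of which lies,
for some member `U` of the cover, in the identity component `G_U` of the group of those elements of
`G` that are compactly supported in `U`. -/
def Factorizable (G : Subgroup (Diff m r M)) : Prop :=
  ∀ 𝒰 : Set (Set M), (∀ U ∈ 𝒰, IsOpen U) → ⋃₀ 𝒰 = Set.univ →
    ∀ g ∈ G, ∃ l : List (Diff m r M), l.prod = g ∧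
      ∀ h ∈ l, ∃ U ∈ 𝒰, h ∈ identityComponent (supportedIn G U)

/-- `G(x) ≠ {x}` for every point `x`. -/
def NonFixing (G : Subgroup (Diff m r M)) : Prop :=
  ∀ x : M, ∃ g ∈ G, g x ≠ x

variable (m r M) in
/-- A `C^r`-arrow: a `C^r` map `φ` from an open subset of `ℝ × M` to `M` such that each `φ_t` is a
diffeomorphism between (possibly empty) open subsets of `M`, `φ_0` is the identity on its domain,
and `dom φ_t ⊆ dom φ_s` for `0 ≤ s < t`. -/
structure Arrow where
  dom : Set (ℝ × M)
  toFun : ℝ → M → M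
  isOpen_dom : IsOpen dom
  contMDiffOn : ContMDiffOn (𝓘(ℝ, ℝ).prod (𝓡 m)) (𝓡 m) (r : WithTop ℕ∞)
    (fun p : ℝ × M => toFun p.1 p.2) dom
  localDiffeo : ∀ t : ℝ, ∃ Φ : PartialDiffeomorph (𝓡 m) (𝓡 m) M M (r : WithTop ℕ∞),
    Φ.source = {x | (t, x) ∈ dom} ∧ ∀ x ∈ Φ.source, Φ.toFun x = toFun t x
  zero : ∀ x, ((0 : ℝ), x) ∈ dom → toFun 0 x = x
  antitone : ∀ s t : ℝ, 0 ≤ s → s < t → ∀ x, (t, x) ∈ dom → (s, x) ∈ dom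

/-- The accessibility relation of a set `A` of arrows: `y` is obtained from `x` by a finite
composition (possibly empty) of maps `φ_t` and `(φ_t)⁻¹` with `φ ∈ A`. Its classes are the
accessible sets of `A`, which are the leaves of the singular foliation defined by `A`. -/
def accessibility (A : Set (Arrow m r M)) : Setoid M :=
  Relation.EqvGen.setoid fun x y => ∃ φ ∈ A, ∃ t : ℝ, (t, x) ∈ φ.dom ∧ φ.toFun t x = y

/-- The arrows which are restrictions of isotopies in `G` to open subsets of `ℝ × M`. -/
def arrowsOf (G : Subgroup (Diff m r M)) : Set (Arrow m r M) :=
  {φ | ∃ f : ℝ → Diff m r M, IsIsotopy f ∧ (∀ t, f t ∈ G) ∧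
    ∀ p ∈ φ.dom, φ.toFun p.1 p.2 = f p.1 p.2}

/-- The singular foliation `F_G` determined by `G`, as the partition of `M` into leaves. -/
def foliation (G : Subgroup (Diff m r M)) : Setoid M := accessibility (arrowsOf G)

/-- All leaves (classes) of the partition are dense. -/
def AllLeavesDense (F : Setoid M) : Prop := ∀ L ∈ F.classes, Dense L

/-- A saturated set is a union of leaves. -/
def IsSaturated (F : Setoid M) (S : Set M) : Prop := ∃ C ⊆ F.classes, S = ⋃₀ C

/-- A minimal set is a minimal element, for inclusion, among the nonempty closed saturated sets. -/
def IsMinimalSet (F : Setoid M) (S : Set M) : Prop :=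
  Minimal (fun T : Set M => T.Nonempty ∧ IsClosed T ∧ IsSaturated F T) S

/-- There is no minimal set other than `M` itself. -/
def NoProperMinimalSet (F : Setoid M) : Prop :=
  ∀ S : Set M, IsMinimalSet F S → S = Set.univ

end DiffGroups

/-!
Write `D = ⁅G, G⁆`. Since a family of diffeomorphisms depending smoothly on a parameter has smoothly
varying inverses (implicit function theorem), the commutators of two isotopies in `G` form an
isotopy in `D`; hence `D` is isotopically connected and the leaves of its foliation are its orbits.
So the theorem is about a group acting by homeomorphisms: `D` is simple if and only if it acts
minimally.

If `D` acts minimally, let `N ≠ 1` be normal in `D`. Every point has a neighbourhood which is moved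
off itself by some `n ∈ N`, and the identity `⁅⁅⁅g, k⁆, n⁆, ⁅h, l⁆⁆ = ⁅g, h⁆`, for `g`, `h`
supported in a smaller neighbourhood and suitable `k`, `l`, puts `⁅g, h⁆` into `N`. Fragmentation
with respect to a fine cover generates all of `D` from conjugates by `G` of such commutators. These
conjugates lie in `N`, although `N` is normal in `D` only, because any fragment of an element of `G`
is, modulo `D`, supported away from a given commutator. Conversely, if `S` is a closed `D`-invariant
set, the elements of `D` fixing `S` pointwise form a normal subgroup, which is neither trivial nor
all of `D` unless `S` is `M` or empty.

On a compact `M` every nonempty closed invariant set contains a minimal one by Zorn's lemma.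
-/

namespace DiffGroups

open Set Filter Topology MulAction
open scoped Pointwise commutatorElement

section Covers

variable {X : Type*} [TopologicalSpace X] [T2Space X] [ParacompactSpace X]

theorem exists_refinement_union_subset {𝒱 : Set (Set X)} (ho : ∀ V ∈ 𝒱, IsOpen V)
    (hc : ⋃₀ 𝒱 = univ) :
    ∃ 𝒰 : Set (Set X), (∀ U ∈ 𝒰, IsOpen U) ∧ ⋃₀ 𝒰 = univ ∧
      ∀ A ∈ 𝒰, ∀ B ∈ 𝒰, (A ∩ B).Nonempty → ∃ V ∈ 𝒱, A ∪ B ⊆ V := by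
  obtain ⟨u, uo, uc, ulf, us⟩ := precise_refinement (fun V : 𝒱 => (V : Set X))
    (fun V => ho V V.2) (by rw [← sUnion_eq_iUnion, hc])
  obtain ⟨F, Fc, Fcl, Fu⟩ := exists_iUnion_eq_closed_subset uo (fun x => ulf.point_finite x) uc
  have Flf : LocallyFinite F := ulf.subset Fu
  let W : X → Set X := fun x => (⋂ i ∈ {i | x ∈ F i}, u i) ∩ (⋃ i : {i // x ∉ F i}, F i)ᶜ
  have hWo : ∀ x, IsOpen (W x) := fun x =>
    ((Flf.point_finite x).isOpen_biInter fun i _ => uo i).inter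
      ((Flf.comp_injective Subtype.val_injective).isClosed_iUnion fun i => Fcl i.1).isOpen_compl
  have hxW : ∀ x, x ∈ W x := fun x =>
    ⟨mem_iInter₂.2 fun i hi => Fu i hi, by simp⟩
  have hWu : ∀ x y i, y ∈ W x → y ∈ F i → W x ⊆ u i := by
    intro x y i hy hi
    have hxi : x ∈ F i := by_contra fun h => hy.2 (mem_iUnion.2 ⟨⟨i, h⟩, hi⟩)
    exact inter_subset_left.trans (biInter_subset_of_mem hxi)
  refine ⟨range W, forall_mem_range.2 hWo, ?_, ?_⟩
  · exact eq_univ_of_forall fun x => ⟨W x, mem_range_self x, hxW x⟩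
  · rintro _ ⟨a, rfl⟩ _ ⟨b, rfl⟩ ⟨y, hya, hyb⟩
    obtain ⟨i, hi⟩ := iUnion_eq_univ_iff.1 Fc y
    exact ⟨i, i.2, (union_subset (hWu a y i hya hi) (hWu b y i hyb hi)).trans (us i)⟩

theorem exists_refinement_union_union_subset {𝒱 : Set (Set X)} (ho : ∀ V ∈ 𝒱, IsOpen V)
    (hc : ⋃₀ 𝒱 = univ) :
    ∃ 𝒰 : Set (Set X), (∀ U ∈ 𝒰, IsOpen U) ∧ ⋃₀ 𝒰 = univ ∧
      ∀ A ∈ 𝒰, ∀ B ∈ 𝒰, ∀ C ∈ 𝒰, (A ∩ B).Nonempty → ((A ∪ B) ∩ C).Nonempty →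
        ∃ V ∈ 𝒱, A ∪ B ∪ C ⊆ V := by
  obtain ⟨𝒲, hWo, hWc, hW⟩ := exists_refinement_union_subset ho hc
  obtain ⟨𝒰, hUo, hUc, hU⟩ := exists_refinement_union_subset hWo hWc
  refine ⟨𝒰, hUo, hUc, fun A hA B hB C hC hAB ⟨x, hx, hxC⟩ => ?_⟩
  obtain ⟨S, hS, hABS⟩ := hU A hA B hB hAB
  obtain ⟨T, hT, hCT, hxT⟩ : ∃ T ∈ 𝒲, C ⊆ T ∧ x ∈ T := by
    rcases hx with hxA | hxB
    · obtain ⟨T, hT, hACT⟩ := hU A hA C hC ⟨x, hxA, hxC⟩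
      exact ⟨T, hT, subset_union_right.trans hACT, hACT (Or.inl hxA)⟩
    · obtain ⟨T, hT, hBCT⟩ := hU B hB C hC ⟨x, hxB, hxC⟩
      exact ⟨T, hT, subset_union_right.trans hBCT, hBCT (Or.inl hxB)⟩
  obtain ⟨V, hV, hSTV⟩ := hW S hS T hT ⟨x, hABS hx, hxT⟩
  exact ⟨V, hV, (union_subset_union hABS hCT).trans hSTV⟩

end Covers

section Commutators

variable {Γ : Type*} [Group Γ]

theorem commutator_le_iff_le_comap_centralizer {H K N : Subgroup Γ} [N.Normal] :
    ⁅H, K⁆ ≤ N ↔ H ≤ (Subgroup.centralizer (K.map (QuotientGroup.mk' N) : Set (Γ ⧸ N))).comap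
      (QuotientGroup.mk' N) := by
  rw [← Subgroup.map_le_iff_le_comap, ← Subgroup.commutator_eq_bot_iff_le_centralizer,
    ← Subgroup.map_commutator, Subgroup.map_eq_bot_iff, QuotientGroup.ker_mk']

theorem iSup_commutator_le {ι : Sort*} {H : ι → Subgroup Γ} {K N : Subgroup Γ} [N.Normal] :
    ⁅⨆ i, H i, K⁆ ≤ N ↔ ∀ i, ⁅H i, K⁆ ≤ N := by
  simp only [commutator_le_iff_le_comap_centralizer, iSup_le_iff]

theorem commutator_le_of_iSup_eq_top {ι : Sort*} {H : ι → Subgroup Γ} {N : Subgroup Γ} [N.Normal]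
    (hH : ⨆ i, H i = ⊤) (h : ∀ i j, ⁅H i, H j⁆ ≤ N) : commutator Γ ≤ N := by
  rw [commutator_def, ← hH, iSup_commutator_le]
  intro i
  rw [Subgroup.commutator_comm, iSup_commutator_le]
  exact fun j => h j i

theorem mem_commutator_sup_of_conj_mem {H : Subgroup Γ} {c k : Γ} (h : k * c * k⁻¹ ∈ H) :
    c ∈ commutator Γ ⊔ H := by
  have hc : c = ⁅c, k⁆ * (k * c * k⁻¹) := by simp [commutatorElement_def, mul_assoc]
  rw [hc]
  exact Subgroup.mul_mem_sup
    (Subgroup.commutator_mem_commutator (Subgroup.mem_top c) (Subgroup.mem_top k)) h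

theorem mem_normalCore_of_sup_centralizer_eq_top {N D : Subgroup Γ} [D.Normal] {z : Γ}
    (hN : D ≤ Subgroup.normalizer (N : Set Γ)) (hz : z ∈ N)
    (h : D ⊔ Subgroup.centralizer {z} = ⊤) : z ∈ N.normalCore := by
  intro b
  obtain ⟨d, hd, e, he, rfl⟩ := Subgroup.mem_sup_of_normal_left.1 (h ▸ Subgroup.mem_top b)
  have hconj : d * e * z * (d * e)⁻¹ = d * z * d⁻¹ := by
    rw [mul_assoc d e, Subgroup.mem_centralizer_singleton_iff.1 he]
    group
  rw [hconj]
  exact (hN hd z).1 hz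

theorem commutatorElement_mem_of_mem_normalizer {N : Subgroup Γ} {a n : Γ}
    (ha : a ∈ Subgroup.normalizer (N : Set Γ)) (hn : n ∈ N) : ⁅a, n⁆ ∈ N :=
  mul_mem ((ha n).1 hn) (inv_mem hn)

theorem commutatorElement_commutatorElement_left_eq {g k b : Γ} (h : Commute (k * g⁻¹ * k⁻¹) b) :
    ⁅⁅g, k⁆, b⁆ = ⁅g, b⁆ :=
  calc ⁅⁅g, k⁆, b⁆ = g * ((k * g⁻¹ * k⁻¹) * b * (k * g⁻¹ * k⁻¹)⁻¹) * g⁻¹ * b⁻¹ := by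
        simp only [commutatorElement_def]; group
    _ = ⁅g, b⁆ := by rw [h.eq, mul_inv_cancel_right, commutatorElement_def]

end Commutators

section Actions

variable {Γ X : Type*} [Group Γ] [MulAction Γ X]

variable (Γ) in
/-- The rigid stabilizer of `U`: the subgroup of those elements which move no point outside `U`. -/
def rigidStabilizer (U : Set X) : Subgroup Γ := fixingSubgroup Γ Uᶜ

variable (Γ) in
/-- A set is displaceable if some element of the group moves it off itself. -/
def IsDisplaceable (U : Set X) : Prop := ∃ k : Γ, Disjoint (k • U) U

variable (Γ X) in
/-- For every open cover, the group is generated by the rigid stabilizers of its members. This is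
what remains of factorizability for an arbitrary action on a topological space. -/
def Fragmentable [TopologicalSpace X] : Prop :=
  ∀ 𝒰 : Set (Set X), (∀ U ∈ 𝒰, IsOpen U) → ⋃₀ 𝒰 = univ →
    ⨆ U : 𝒰, rigidStabilizer Γ (U : Set X) = ⊤

variable {U V W : Set X} {g h k : Γ} {x : X}

theorem mem_rigidStabilizer : g ∈ rigidStabilizer Γ U ↔ ∀ x ∉ U, g • x = x :=
  mem_fixingSubgroup_iff Γ

theorem rigidStabilizer_mono (h : U ⊆ V) : rigidStabilizer Γ U ≤ rigidStabilizer Γ V :=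
  fixingSubgroup_antitone Γ X (compl_subset_compl.2 h)

theorem smul_mem_of_mem_rigidStabilizer (hg : g ∈ rigidStabilizer Γ U) (hx : x ∈ U) :
    g • x ∈ U :=
  orbit_fixingSubgroup_compl_subset Γ X hx ⟨⟨g, hg⟩, rfl⟩

theorem conj_mem_rigidStabilizer_smul (hg : g ∈ rigidStabilizer Γ U) (k : Γ) :
    k * g * k⁻¹ ∈ rigidStabilizer Γ (k • U) := by
  refine mem_rigidStabilizer.2 fun x hx => ?_
  rw [mul_smul, mul_smul,
    mem_rigidStabilizer.1 hg _ fun h => hx (mem_smul_set_iff_inv_smul_mem.2 h), smul_inv_smul]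

theorem commutatorElement_mem_rigidStabilizer (hg : g ∈ rigidStabilizer Γ U) (k : Γ) :
    ⁅g, k⁆ ∈ rigidStabilizer Γ (U ∪ k • U) := by
  have hk := rigidStabilizer_mono (subset_union_right (s := U))
    (conj_mem_rigidStabilizer_smul (inv_mem hg) k)
  simpa only [commutatorElement_def, mul_assoc] using
    mul_mem (rigidStabilizer_mono subset_union_left hg) hk

theorem IsDisplaceable.mono (hU : IsDisplaceable Γ U) (h : V ⊆ U) : IsDisplaceable Γ V :=
  hU.imp fun _ hk => hk.mono (smul_set_mono h) h

theorem normal_fixingSubgroup {S : Set X} (hS : ∀ g : Γ, g • S ⊆ S) :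
    (fixingSubgroup Γ S).Normal := by
  refine ⟨fun n hn g => (mem_fixingSubgroup_iff Γ).2 fun x hx => ?_⟩
  rw [mul_smul, mul_smul, (mem_fixingSubgroup_iff Γ).1 hn _ (hS g⁻¹ (smul_mem_smul_set hx)),
    smul_inv_smul]

theorem orbit_map_subtype {G : Subgroup Γ} (D : Subgroup G) (x : X) :
    orbit (D.map G.subtype) x = orbit D x := by
  ext y
  constructor
  · rintro ⟨⟨_, d, hd, rfl⟩, rfl⟩
    exact ⟨⟨d, hd⟩, rfl⟩
  · rintro ⟨⟨d, hd⟩, rfl⟩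
    exact ⟨⟨d, d, hd, rfl⟩, rfl⟩

theorem isMinimal_map_subtype_iff [TopologicalSpace X] {G : Subgroup Γ} {D : Subgroup G} :
    IsMinimal (D.map G.subtype) X ↔ IsMinimal D X :=
  ⟨fun h => ⟨fun x => orbit_map_subtype D x ▸ h.dense_orbit x⟩,
    fun h => ⟨fun x => (orbit_map_subtype D x).symm ▸ h.dense_orbit x⟩⟩

section Faithful

variable [FaithfulSMul Γ X]

theorem commute_of_disjoint (hUV : Disjoint U V) (hg : g ∈ rigidStabilizer Γ U)
    (hh : h ∈ rigidStabilizer Γ V) : Commute g h := by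
  have hdisj : (toPermHom Γ X g).Disjoint (toPermHom Γ X h) := fun x =>
    (em (x ∈ U)).symm.imp (mem_rigidStabilizer.1 hg x)
      fun hx => mem_rigidStabilizer.1 hh x (disjoint_left.1 hUV hx)
  exact hdisj.commute.of_map toPerm_injective

theorem commutatorElement_commutatorElement_left_eq_of_disjoint (hg : g ∈ rigidStabilizer Γ U)
    (hh : h ∈ rigidStabilizer Γ V) (hk : Disjoint (k • U) V) : ⁅⁅g, k⁆, h⁆ = ⁅g, h⁆ :=
  commutatorElement_commutatorElement_left_eq
    (commute_of_disjoint hk (conj_mem_rigidStabilizer_smul (inv_mem hg) k) hh)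

theorem commutatorElement_commutatorElement_right_eq_of_disjoint (hg : g ∈ rigidStabilizer Γ U)
    (hh : h ∈ rigidStabilizer Γ V) (hk : Disjoint (k • V) U) : ⁅g, ⁅h, k⁆⁆ = ⁅g, h⁆ := by
  rw [← commutatorElement_inv, commutatorElement_commutatorElement_left_eq_of_disjoint hh hg hk,
    commutatorElement_inv]

/-- A fragment `c` with support `C` meeting `W` is, modulo commutators, a conjugate of `c` whose
support is disjoint from `W`. -/
theorem commutator_sup_centralizer_eq_top {𝒰 : Set (Set X)}
    (hgen : ⨆ C : 𝒰, rigidStabilizer Γ (C : Set X) = ⊤) {z : Γ} (hz : z ∈ rigidStabilizer Γ W)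
    (hW : ∀ C ∈ 𝒰, (W ∩ C).Nonempty → IsDisplaceable Γ (W ∪ C)) :
    commutator Γ ⊔ Subgroup.centralizer {z} = ⊤ := by
  have hcent : ∀ {C : Set X} {c : Γ}, c ∈ rigidStabilizer Γ C → Disjoint C W →
      c ∈ Subgroup.centralizer {z} := fun hc hCW =>
    Subgroup.mem_centralizer_singleton_iff.2 (commute_of_disjoint hCW hc hz).eq
  rw [eq_top_iff, ← hgen, iSup_le_iff]
  rintro ⟨C, hC⟩ c hc
  by_cases hWC : Disjoint W C
  · exact Subgroup.mem_sup_right (hcent hc hWC.symm)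
  · obtain ⟨k, hk⟩ := hW C hC (not_disjoint_iff_nonempty_inter.1 hWC)
    exact mem_commutator_sup_of_conj_mem (hcent (conj_mem_rigidStabilizer_smul hc k)
      (hk.mono (smul_set_mono subset_union_right) subset_union_left))

theorem commutator_le_of_forall_exists_isOpen [TopologicalSpace X] [T2Space X] [ParacompactSpace X]
    (hfrag : Fragmentable Γ X) {N : Subgroup Γ}
    (hN : commutator Γ ≤ Subgroup.normalizer (N : Set Γ))
    (hloc : ∀ x : X, ∃ U, IsOpen U ∧ x ∈ U ∧ IsDisplaceable Γ U ∧
      ⁅rigidStabilizer Γ U, rigidStabilizer Γ U⁆ ≤ N) :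
    commutator Γ ≤ N := by
  obtain ⟨𝒰, hUo, hUc, hU⟩ := exists_refinement_union_union_subset
    (𝒱 := {U : Set X | IsOpen U ∧ IsDisplaceable Γ U ∧
      ⁅rigidStabilizer Γ U, rigidStabilizer Γ U⁆ ≤ N}) (fun V hV => hV.1)
    (eq_univ_of_forall fun x =>
      let ⟨U, hUo, hxU, hUd⟩ := hloc x
      ⟨U, ⟨hUo, hUd⟩, hxU⟩)
  have hgen := hfrag 𝒰 hUo hUc
  suffices hcore : ∀ A B : 𝒰, ⁅rigidStabilizer Γ (A : Set X), rigidStabilizer Γ (B : Set X)⁆ ≤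
      N.normalCore from (commutator_le_of_iSup_eq_top hgen hcore).trans N.normalCore_le
  rintro ⟨A, hA⟩ ⟨B, hB⟩
  refine Subgroup.commutator_le.2 fun a ha b hb => ?_
  by_cases hAB : Disjoint A B
  · rw [commutatorElement_eq_one_iff_commute.2 (commute_of_disjoint hAB ha hb)]
    exact one_mem _
  replace hAB := not_disjoint_iff_nonempty_inter.1 hAB
  replace ha := rigidStabilizer_mono (subset_union_left (t := B)) ha
  replace hb := rigidStabilizer_mono (subset_union_right (s := A)) hb
  have habN : ⁅a, b⁆ ∈ N := by
    obtain ⟨V, ⟨-, -, hVN⟩, hV⟩ := hU A hA B hB B hB hAB (hAB.mono fun x hx => ⟨.inl hx.1, hx.2⟩)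
    have hABV := rigidStabilizer_mono (Γ := Γ) (subset_union_left.trans hV)
    exact hVN (Subgroup.commutator_mem_commutator (hABV ha) (hABV hb))
  have habAB : ⁅a, b⁆ ∈ rigidStabilizer Γ (A ∪ B) :=
    Subgroup.commutator_le_self _ (Subgroup.commutator_mem_commutator ha hb)
  refine mem_normalCore_of_sup_centralizer_eq_top hN habN
    (commutator_sup_centralizer_eq_top hgen habAB fun C hC hABC => ?_)
  obtain ⟨V, ⟨-, hVd, -⟩, hV⟩ := hU A hA B hB C hC hAB hABC
  exact hVd.mono hV

end Faithful

section Topological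

variable [TopologicalSpace X]

theorem exists_mem_rigidStabilizer_smul_ne [T1Space X] (hfrag : Fragmentable Γ X)
    (hmove : ∃ g : Γ, g • x ≠ x) (hU : IsOpen U) (hx : x ∈ U) :
    ∃ g ∈ rigidStabilizer Γ U, g • x ≠ x := by
  by_contra! hfix
  obtain ⟨g, hg⟩ := hmove
  have hgen := hfrag {U, {x}ᶜ} (by rintro V (rfl | rfl); exacts [hU, isOpen_compl_singleton])
    (by
      rw [sUnion_pair, ← univ_subset_iff, ← union_compl_self {x}]
      exact union_subset_union_left _ (singleton_subset_iff.2 hx))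
  suffices hle : (⊤ : Subgroup Γ) ≤ stabilizer Γ x from hg (hle (Subgroup.mem_top g))
  rw [← hgen, iSup_le_iff]
  rintro ⟨V, rfl | rfl⟩ k hk
  · exact hfix k hk
  · exact mem_rigidStabilizer.1 hk x (by simp)

theorem exists_commutator_mem_rigidStabilizer_smul_ne [T1Space X] (hfrag : Fragmentable Γ X)
    (hmove : ∃ g : Γ, g • x ≠ x) (hU : IsOpen U) (hx : x ∈ U) :
    ∃ d : commutator Γ, d ∈ rigidStabilizer (commutator Γ) U ∧ d • x ≠ x := by
  obtain ⟨h, hh, hhx⟩ := exists_mem_rigidStabilizer_smul_ne hfrag hmove hU hx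
  have hne : x ≠ h⁻¹ • x := fun e => hhx (eq_inv_smul_iff.1 e)
  obtain ⟨g, hg, hgx⟩ := exists_mem_rigidStabilizer_smul_ne hfrag hmove
    (hU.inter isOpen_compl_singleton) ⟨hx, hne⟩
  have hghU : ⁅g, h⁆ ∈ rigidStabilizer Γ U := Subgroup.commutator_le_self _
    (Subgroup.commutator_mem_commutator (rigidStabilizer_mono inter_subset_left hg) hh)
  have hghx : ⁅g, h⁆ • x = g • x := by
    have hfix : g⁻¹ • h⁻¹ • x = h⁻¹ • x := mem_rigidStabilizer.1 (inv_mem hg) _ (by simp)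
    rw [commutatorElement_def, mul_smul, mul_smul, hfix, mul_smul, smul_inv_smul]
  exact ⟨⟨⁅g, h⁆, Subgroup.commutator_mem_commutator (Subgroup.mem_top g) (Subgroup.mem_top h)⟩,
    mem_rigidStabilizer.2 (mem_rigidStabilizer.1 hghU), hghx.trans_ne hgx⟩

variable [T2Space X] [ContinuousConstSMul Γ X]

theorem eventually_disjoint_smul_smallSets (hne : g • x ≠ h • x) :
    ∀ᶠ U in (𝓝 x).smallSets, Disjoint (g • U) (h • U) := by
  obtain ⟨A, B, hA, hB, hxA, hxB, hAB⟩ := t2_separation hne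
  refine eventually_smallSets.2 ⟨(g • ·) ⁻¹' A ∩ (h • ·) ⁻¹' B, ?_, fun U hU => hAB.mono ?_ ?_⟩
  · exact inter_mem ((continuous_const_smul g).continuousAt (hA.mem_nhds hxA))
      ((continuous_const_smul h).continuousAt (hB.mem_nhds hxB))
  · exact image_subset_iff.2 fun y hy => (hU hy).1
  · exact image_subset_iff.2 fun y hy => (hU hy).2

theorem exists_isOpen_pairwise_disjoint_smul (hfrag : Fragmentable Γ X)
    (hmove : ∃ g : Γ, g • x ≠ x) (hV : V ∈ 𝓝 x) :
    ∃ U ⊆ V, IsOpen U ∧ x ∈ U ∧ ∃ k ∈ rigidStabilizer Γ V, ∃ l ∈ rigidStabilizer Γ V,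
      Disjoint (k • U) U ∧ Disjoint (l • U) U ∧ Disjoint (k • U) (l • U) := by
  obtain ⟨V', hV'V, hV', hxV'⟩ := mem_nhds_iff.1 hV
  obtain ⟨k, hk, hkx⟩ := exists_mem_rigidStabilizer_smul_ne hfrag hmove hV' hxV'
  have hxk : x ∈ V' ∩ {k • x}ᶜ := ⟨hxV', hkx.symm⟩
  obtain ⟨l, hl, hlx⟩ := exists_mem_rigidStabilizer_smul_ne hfrag hmove
    (hV'.inter isOpen_compl_singleton) hxk
  have hlk : k • x ≠ l • x := fun e => (smul_mem_of_mem_rigidStabilizer hl hxk).2 e.symm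
  have hsmall : ∀ᶠ U in (𝓝 x).smallSets, U ⊆ V ∧ Disjoint (k • U) ((1 : Γ) • U) ∧
      Disjoint (l • U) ((1 : Γ) • U) ∧ Disjoint (k • U) (l • U) :=
    (eventually_smallSets.2 ⟨V, hV, fun _ h => h⟩).and <|
      (eventually_disjoint_smul_smallSets ((one_smul Γ x).symm ▸ hkx)).and <|
      (eventually_disjoint_smul_smallSets ((one_smul Γ x).symm ▸ hlx)).and <|
      eventually_disjoint_smul_smallSets hlk
  obtain ⟨T, hT, hdisj⟩ := eventually_smallSets.1 hsmall
  obtain ⟨U, hUT, hUo, hxU⟩ := mem_nhds_iff.1 hT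
  obtain ⟨hUV, hkU, hlU, hklU⟩ := hdisj U hUT
  rw [one_smul] at hkU hlU
  exact ⟨U, hUV, hUo, hxU, k, rigidStabilizer_mono hV'V hk, l,
    rigidStabilizer_mono (inter_subset_left.trans hV'V) hl, hkU, hlU, hklU⟩

instance (G : Subgroup Γ) : ContinuousConstSMul G X := ⟨fun g => continuous_const_smul (g : Γ)⟩

theorem isMinimal_commutator_of_isSimpleGroup [IsSimpleGroup (commutator Γ)]
    (hfrag : Fragmentable Γ X) (hmove : ∀ x : X, ∃ g : Γ, g • x ≠ x) :
    IsMinimal (commutator Γ) X := by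
  refine (isMinimal_iff_isClosed_smul_invariant _).2 fun S hS hinv => ?_
  rcases (normal_fixingSubgroup hinv).eq_bot_or_eq_top with hbot | htop
  · refine Or.inr (eq_univ_of_forall fun x => by_contra fun hx => ?_)
    obtain ⟨d, hd, hdx⟩ :=
      exists_commutator_mem_rigidStabilizer_smul_ne hfrag (hmove x) hS.isOpen_compl hx
    rw [rigidStabilizer, compl_compl, hbot, Subgroup.mem_bot] at hd
    exact hdx (by rw [hd, one_smul])
  · refine Or.inl (eq_empty_of_forall_notMem fun x hx => ?_)
    obtain ⟨d, -, hdx⟩ :=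
      exists_commutator_mem_rigidStabilizer_smul_ne hfrag (hmove x) isOpen_univ (mem_univ x)
    exact hdx ((mem_fixingSubgroup_iff _).1 (htop ▸ Subgroup.mem_top d) x hx)

variable [FaithfulSMul Γ X]

/-- If `n` displaces `V`, and `k`, `l` are supported in `V` and push the small set `U` off itself in
disjoint ways, then `⁅⁅⁅g, k⁆, n⁆, ⁅h, l⁆⁆ = ⁅g, h⁆` for all `g`, `h` supported in `U`. -/
theorem exists_isOpen_commutator_rigidStabilizer_le (hfrag : Fragmentable Γ X)
    (hmove : ∃ g : Γ, g • x ≠ x) {N : Subgroup Γ}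
    (hN : commutator Γ ≤ Subgroup.normalizer (N : Set Γ)) {n : Γ} (hn : n ∈ N) (hnx : n • x ≠ x) :
    ∃ U, IsOpen U ∧ x ∈ U ∧ IsDisplaceable Γ U ∧
      ⁅rigidStabilizer Γ U, rigidStabilizer Γ U⁆ ≤ N := by
  obtain ⟨V, hV, hnV⟩ : ∃ V ∈ 𝓝 x, Disjoint (n • V) V := by
    obtain ⟨V, hV, hdisj⟩ := eventually_smallSets.1
      (eventually_disjoint_smul_smallSets (show n • x ≠ (1 : Γ) • x by rwa [one_smul]))
    exact ⟨V, hV, by simpa only [one_smul] using hdisj V subset_rfl⟩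
  obtain ⟨U, hUV, hU, hxU, k, hk, l, hl, hkU, hlU, hklU⟩ :=
    exists_isOpen_pairwise_disjoint_smul hfrag hmove hV
  refine ⟨U, hU, hxU, ⟨k, hkU⟩, Subgroup.commutator_le.2 fun g hg h hh => ?_⟩
  have hV_comm : ∀ {g k : Γ}, g ∈ rigidStabilizer Γ U → k ∈ rigidStabilizer Γ V →
      ⁅g, k⁆ ∈ rigidStabilizer Γ V := fun hg hk => Subgroup.commutator_le_self _
    (Subgroup.commutator_mem_commutator (rigidStabilizer_mono hUV hg) hk)
  have hD_comm : ∀ g k : Γ, ⁅g, k⁆ ∈ Subgroup.normalizer (N : Set Γ) := fun g k =>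
    hN (Subgroup.commutator_mem_commutator (Subgroup.mem_top g) (Subgroup.mem_top k))
  have hgh : ⁅⁅⁅g, k⁆, n⁆, ⁅h, l⁆⁆ = ⁅g, h⁆ :=
    calc ⁅⁅⁅g, k⁆, n⁆, ⁅h, l⁆⁆ = ⁅⁅g, k⁆, ⁅h, l⁆⁆ :=
          commutatorElement_commutatorElement_left_eq_of_disjoint (hV_comm hg hk) (hV_comm hh hl)
            hnV
      _ = ⁅g, ⁅h, l⁆⁆ :=
          commutatorElement_commutatorElement_left_eq_of_disjoint hg
            (commutatorElement_mem_rigidStabilizer hh l) (disjoint_union_right.2 ⟨hkU, hklU⟩)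
      _ = ⁅g, h⁆ := commutatorElement_commutatorElement_right_eq_of_disjoint hg hh hlU
  have hgkn : ⁅⁅g, k⁆, n⁆ ∈ N := commutatorElement_mem_of_mem_normalizer (hD_comm g k) hn
  rw [← hgh, ← commutatorElement_inv]
  exact inv_mem (commutatorElement_mem_of_mem_normalizer (hD_comm h l) hgkn)

theorem commutator_le_of_isMinimal [ParacompactSpace X] [IsMinimal (commutator Γ) X]
    (hfrag : Fragmentable Γ X) (hmove : ∀ x : X, ∃ g : Γ, g • x ≠ x) {N : Subgroup Γ}
    (hN : commutator Γ ≤ Subgroup.normalizer (N : Set Γ)) (hbot : N ≠ ⊥) : commutator Γ ≤ N := by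
  obtain ⟨n, hn, hn1⟩ := N.bot_or_exists_ne_one.resolve_left hbot
  obtain ⟨p, hp⟩ : ∃ p : X, n • p ≠ p := by
    by_contra! h
    exact hn1 (FaithfulSMul.eq_of_smul_eq_smul (α := X) fun x => by rw [h, one_smul])
  have hmoved : IsOpen {y : X | n • y ≠ y} := isOpen_ne_fun (continuous_const_smul n) continuous_id
  refine commutator_le_of_forall_exists_isOpen hfrag hN fun x => ?_
  obtain ⟨⟨d, hd⟩, hdx : n • d • x ≠ d • x⟩ := hmoved.exists_smul_mem (commutator Γ) x ⟨p, hp⟩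
  refine exists_isOpen_commutator_rigidStabilizer_le hfrag (hmove x) hN
    (n := d⁻¹ * n * d⁻¹⁻¹) ((hN (inv_mem hd) n).1 hn) fun h => hdx ?_
  rwa [inv_inv, mul_smul, mul_smul, inv_smul_eq_iff] at h

theorem isSimpleGroup_commutator_of_isMinimal [ParacompactSpace X] [Nonempty X]
    [IsMinimal (commutator Γ) X] (hfrag : Fragmentable Γ X)
    (hmove : ∀ x : X, ∃ g : Γ, g • x ≠ x) : IsSimpleGroup (commutator Γ) := by
  obtain ⟨x⟩ := ‹Nonempty X›
  obtain ⟨d, -, hdx⟩ :=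
    exists_commutator_mem_rigidStabilizer_smul_ne hfrag (hmove x) isOpen_univ (mem_univ x)
  have : Nontrivial (commutator Γ) := ⟨d, 1, fun h => hdx (by rw [h, one_smul])⟩
  refine ⟨fun H hH => or_iff_not_imp_left.2 fun hbot => ?_⟩
  have hmap : (H.map (commutator Γ).subtype).subgroupOf (commutator Γ) = H :=
    Subgroup.comap_map_eq_self_of_injective (Subgroup.subtype_injective _) H
  rw [← hmap, Subgroup.subgroupOf_eq_top]
  refine commutator_le_of_isMinimal hfrag hmove ?_
    (mt (Subgroup.map_eq_bot_iff_of_injective _ (Subgroup.subtype_injective _)).1 hbot)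
  rwa [← Subgroup.normal_subgroupOf_iff_le_normalizer (Subgroup.map_subtype_le H), hmap]

theorem isSimpleGroup_commutator_iff_isMinimal [ParacompactSpace X] [Nonempty X]
    {G : Subgroup Γ} (hfrag : Fragmentable G X) (hmove : ∀ x : X, ∃ g ∈ G, g • x ≠ x) :
    IsSimpleGroup ↥⁅G, G⁆ ↔ IsMinimal ↥⁅G, G⁆ X := by
  have hmove' : ∀ x : X, ∃ g : G, g • x ≠ x := fun x =>
    let ⟨g, hg, hgx⟩ := hmove x
    ⟨⟨g, hg⟩, hgx⟩
  have e := (commutator G).equivMapOfInjective G.subtype G.subtype_injective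
  rw [← G.map_subtype_commutator, isMinimal_map_subtype_iff]
  constructor
  · intro _
    have := e.isSimpleGroup
    exact isMinimal_commutator_of_isSimpleGroup hfrag hmove'
  · intro _
    have := isSimpleGroup_commutator_of_isMinimal hfrag hmove'
    exact e.symm.isSimpleGroup

end Topological

end Actions

section Charts

variable {𝕜 : Type*} [NontriviallyNormedField 𝕜]
  {P : Type*} [NormedAddCommGroup P] [NormedSpace 𝕜 P]
  {E : Type*} [NormedAddCommGroup E] [NormedSpace 𝕜 E] {n : WithTop ℕ∞}
  {H : Type*} [TopologicalSpace H] {I : ModelWithCorners 𝕜 E H} [I.Boundaryless]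
  {M : Type*} [TopologicalSpace M] [ChartedSpace H M] [IsManifold I n M]

theorem contMDiffAt_extChartAt_symm_self (x : M) :
    ContMDiffAt 𝓘(𝕜, E) I n (extChartAt I x).symm (extChartAt I x x) :=
  (contMDiffOn_extChartAt_symm x).contMDiffAt (extChartAt_target_mem_nhds x)

theorem contDiffAt_family_extChartAt {e : P → M → M} {t : P} {x : M} (hetx : e t x = x)
    (he : ContMDiffAt (𝓘(𝕜, P).prod I) I n (fun p : P × M => e p.1 p.2) (t, x)) :
    ContDiffAt 𝕜 n (fun q : P × E => extChartAt I x (e q.1 ((extChartAt I x).symm q.2)))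
      (t, extChartAt I x x) := by
  have hφx : (extChartAt I x).symm (extChartAt I x x) = x := extChartAt_to_inv x
  have hpair : ContMDiffAt 𝓘(𝕜, P × E) (𝓘(𝕜, P).prod I) n
      (fun q : P × E => (q.1, (extChartAt I x).symm q.2)) (t, extChartAt I x x) :=
    contDiffAt_fst.contMDiffAt.prodMk
      ((contMDiffAt_extChartAt_symm_self x).comp (t, extChartAt I x x)
        contDiffAt_snd.contMDiffAt)
  have he' := he.comp_of_eq hpair (Prod.ext rfl hφx)
  exact (contMDiffAt_extChartAt.comp_of_eq he' (by simp [hetx])).contDiffAt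

end Charts

section InverseFamily

variable {𝕜 : Type*} [RCLike 𝕜]
  {P : Type*} [NormedAddCommGroup P] [NormedSpace 𝕜 P] [CompleteSpace P]
  {E : Type*} [NormedAddCommGroup E] [NormedSpace 𝕜 E] [CompleteSpace E] {n : WithTop ℕ∞}

theorem exists_contDiffAt_rightInverse_of_family (hn : n ≠ 0) {Φ : P × E → E} {t : P} {u : E}
    (hΦ : ContDiffAt 𝕜 n Φ (t, u)) (hid : ∀ᶠ v in 𝓝 u, Φ (t, v) = v) :
    ∃ Ψ : P × E → E, ContDiffAt 𝕜 n Ψ (t, u) ∧ Ψ (t, u) = u ∧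
      ∀ᶠ q in 𝓝 (t, u), Φ (q.1, Ψ q) = q.2 := by
  let F : (P × E) × E → E := fun q => Φ (q.1.1, q.2) - q.1.2
  have hF : ContDiffAt 𝕜 n F ((t, u), u) :=
    (hΦ.comp ((t, u), u) (contDiffAt_fst.fst.prodMk contDiffAt_snd)).sub contDiffAt_fst.snd
  have hpartial : fderiv 𝕜 F ((t, u), u) ∘L .inr 𝕜 (P × E) E = .id 𝕜 E := by
    have hcomp : HasFDerivAt (fun v => F ((t, u), v))
        (fderiv 𝕜 F ((t, u), u) ∘L .inr 𝕜 (P × E) E) u :=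
      (hF.differentiableAt hn).hasFDerivAt.comp u (hasFDerivAt_prodMk_right (t, u) u)
    have hsub : HasFDerivAt (fun v => F ((t, u), v)) (.id 𝕜 E) u :=
      ((hasFDerivAt_id u).sub_const u).congr_of_eventuallyEq
        (hid.mono fun v hv => congrArg (· - u) hv)
    exact hcomp.unique hsub
  have hinv : (fderiv 𝕜 F ((t, u), u) ∘L .inr 𝕜 (P × E) E).IsInvertible :=
    hpartial ▸ ContinuousLinearMap.isInvertible_equiv (f := .refl 𝕜 E)
  have hF0 : F ((t, u), u) = 0 := sub_eq_zero.2 hid.self_of_nhds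
  refine ⟨hF.implicitFunction hn hinv, hF.contDiffAt_implicitFunction hn hinv,
    hF.implicitFunction_apply_self hn hinv, ?_⟩
  exact (hF.eventually_apply_implicitFunction hn hinv).mono fun q hq =>
    sub_eq_zero.1 (hq.trans hF0)

variable {H : Type*} [TopologicalSpace H] {I : ModelWithCorners 𝕜 E H} [I.Boundaryless]
  {M : Type*} [TopologicalSpace M] [ChartedSpace H M] [IsManifold I n M]

theorem contMDiffAt_symm_family_of_eq_refl (hn : n ≠ 0) {e : P → M ≃ M} {t : P} {x : M}
    (het : e t = Equiv.refl M)
    (he : ContMDiffAt (𝓘(𝕜, P).prod I) I n (fun p : P × M => e p.1 p.2) (t, x)) :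
    ContMDiffAt (𝓘(𝕜, P).prod I) I n (fun p : P × M => (e p.1).symm p.2) (t, x) := by
  let φ := extChartAt I x
  have hφx : φ.symm (φ x) = x := extChartAt_to_inv x
  have hetx : e t x = x := by rw [het, Equiv.refl_apply]
  let Φ : P × E → E := fun q => φ (e q.1 (φ.symm q.2))
  have hΦ : ContDiffAt 𝕜 n Φ (t, φ x) := contDiffAt_family_extChartAt (e := fun s => e s) hetx he
  have hid : ∀ᶠ v in 𝓝 (φ x), Φ (t, v) = v := by
    filter_upwards [extChartAt_target_mem_nhds (I := I) x] with v hv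
    simp only [Φ, het, Equiv.refl_apply, φ.right_inv hv]
  obtain ⟨Ψ, hΨ, hΨx, hΦΨ⟩ := exists_contDiffAt_rightInverse_of_family hn hΦ hid
  let g : P × M → M := fun p => φ.symm (Ψ (p.1, φ p.2))
  have hchart : ContMDiffAt (𝓘(𝕜, P).prod I) 𝓘(𝕜, P × E) n
      (fun p : P × M => (p.1, φ p.2)) (t, x) :=
    contMDiffAt_fst.prodMk_space (contMDiffAt_extChartAt.comp (t, x) contMDiffAt_snd)
  have hg : ContMDiffAt (𝓘(𝕜, P).prod I) I n g (t, x) :=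
    (contMDiffAt_extChartAt_symm_self x).comp_of_eq (hΨ.contMDiffAt.comp (t, x) hchart) hΨx
  have hgx : g (t, x) = x := (congrArg φ.symm hΨx).trans hφx
  refine hg.congr_of_eventuallyEq ?_
  have hsource : ∀ᶠ p in 𝓝 (t, x), e p.1 (g p) ∈ φ.source := by
    have hcont : ContinuousAt (fun p : P × M => e p.1 (g p)) (t, x) :=
      he.continuousAt.comp_of_eq (continuousAt_fst.prodMk hg.continuousAt) (Prod.ext rfl hgx)
    exact hcont.eventually_mem (by simpa only [hgx, hetx] using extChartAt_source_mem_nhds x)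
  filter_upwards [hsource, continuousAt_snd.eventually_mem (extChartAt_source_mem_nhds (I := I) x),
    hchart.continuousAt.eventually hΦΨ] with p hgp hp hΦp
  exact (e p.1).symm_apply_eq.2 (φ.injOn hgp hp hΦp).symm

theorem contMDiff_symm_family {E' : Type*} [NormedAddCommGroup E'] [NormedSpace 𝕜 E']
    {H' : Type*} [TopologicalSpace H'] {J : ModelWithCorners 𝕜 E' H'}
    {N : Type*} [TopologicalSpace N] [ChartedSpace H' N] (hn : n ≠ 0)
    {f : P → Diffeomorph I J M N n}
    (hf : ContMDiff (𝓘(𝕜, P).prod I) J n fun p : P × M => f p.1 p.2) :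
    ContMDiff (𝓘(𝕜, P).prod J) I n fun p : P × N => (f p.1).symm p.2 := by
  rintro ⟨t, y⟩
  have hrel := contMDiffAt_symm_family_of_eq_refl hn (t := t) (x := (f t).symm y)
    (e := fun s => (f s).toEquiv.trans (f t).symm.toEquiv) (Equiv.self_trans_symm _)
    ((f t).symm.contMDiff.comp hf).contMDiffAt
  have hpair : ContMDiff (𝓘(𝕜, P).prod J) (𝓘(𝕜, P).prod I) n
      fun p : P × N => (p.1, (f t).symm p.2) :=
    contMDiff_fst.prodMk ((f t).symm.contMDiff.comp contMDiff_snd)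
  refine (hrel.comp (t, y) hpair.contMDiffAt).congr_of_eventuallyEq (.of_forall fun p => ?_)
  exact congrArg (f p.1).symm ((f t).apply_symm_apply p.2).symm

end InverseFamily

section Leaves

variable {X : Type*}

theorem isSaturated_iff {F : Setoid X} {S : Set X} :
    IsSaturated F S ↔ ∀ x y, F x y → x ∈ S → y ∈ S := by
  constructor
  · rintro ⟨C, hC, rfl⟩ x y hxy ⟨L, hL, hx⟩
    obtain ⟨z, rfl⟩ := hC hL
    exact ⟨_, hL, F.trans (F.symm hxy) hx⟩
  · intro h
    refine ⟨{L ∈ F.classes | L ⊆ S}, sep_subset _ _,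
      Subset.antisymm (fun x hx => ?_) (sUnion_subset fun L hL => hL.2)⟩
    exact ⟨{y | F y x}, ⟨F.mem_classes x, fun y hy => h x y (F.symm hy) hx⟩, F.refl x⟩

theorem isSaturated_orbitRel_iff {Γ : Type*} [Group Γ] [MulAction Γ X] {S : Set X} :
    IsSaturated (orbitRel Γ X) S ↔ ∀ g : Γ, g • S ⊆ S := by
  refine isSaturated_iff.trans ⟨fun h g => ?_, fun h x y hxy hx => ?_⟩
  · rintro _ ⟨x, hx, rfl⟩
    exact h x (g • x) ((orbitRel Γ X).symm (mem_orbit x g)) hx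
  · obtain ⟨g, rfl⟩ := (orbitRel Γ X).symm hxy
    exact h g (smul_mem_smul_set hx)

variable [TopologicalSpace X]

theorem AllLeavesDense.noProperMinimalSet {F : Setoid X} (hF : AllLeavesDense F) :
    NoProperMinimalSet F := by
  rintro S ⟨⟨hne, hclosed, C, hC, rfl⟩, -⟩
  obtain ⟨x, L, hL, -⟩ := hne
  exact univ_subset_iff.1
    ((hF L (hC hL)).closure_eq ▸ closure_minimal (subset_sUnion_of_mem hL) hclosed)

theorem exists_isMinimalSet_subset [CompactSpace X] {F : Setoid X} {S : Set X}
    (hne : S.Nonempty) (hclosed : IsClosed S) (hsat : IsSaturated F S) :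
    ∃ T ⊆ S, IsMinimalSet F T := by
  refine zorn_superset_nonempty {T : Set X | T.Nonempty ∧ IsClosed T ∧ IsSaturated F T}
    (fun c hc hchain hcne => ⟨⋂₀ c, ⟨?_, ?_, ?_⟩, fun s hs => sInter_subset_of_mem hs⟩) S
    ⟨hne, hclosed, hsat⟩
  · have := hcne.to_subtype
    have hdirected : DirectedOn (· ⊇ ·) c := fun A hA B hB =>
      (hchain.total hA hB).elim (⟨A, hA, subset_rfl, ·⟩) (⟨B, hB, ·, subset_rfl⟩)
    exact IsCompact.nonempty_sInter_of_directed_nonempty_isCompact_isClosed hdirected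
      (fun T hT => (hc hT).1) (fun T hT => (hc hT).2.1.isCompact) fun T hT => (hc hT).2.1
  · exact isClosed_sInter fun T hT => (hc hT).2.1
  · exact isSaturated_iff.2 fun x y hxy hx T hT =>
      isSaturated_iff.1 (hc hT).2.2 x y hxy (hx T hT)

variable {Γ : Type*} [Group Γ] [MulAction Γ X]

theorem allLeavesDense_orbitRel_iff : AllLeavesDense (orbitRel Γ X) ↔ IsMinimal Γ X := by
  refine ⟨fun h => ⟨fun x => h _ ((orbitRel Γ X).mem_classes x)⟩, ?_⟩
  rintro h _ ⟨x, rfl⟩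
  exact h.dense_orbit x

theorem NoProperMinimalSet.isMinimal [CompactSpace X] [ContinuousConstSMul Γ X]
    (h : NoProperMinimalSet (orbitRel Γ X)) : IsMinimal Γ X := by
  refine (isMinimal_iff_isClosed_smul_invariant Γ).2 fun S hclosed hinv => ?_
  refine S.eq_empty_or_nonempty.imp_right fun hne => ?_
  obtain ⟨T, hTS, hT⟩ :=
    exists_isMinimalSet_subset hne hclosed (isSaturated_orbitRel_iff.2 hinv)
  exact univ_subset_iff.1 (h T hT ▸ hTS)

end Leaves

section Diffeomorphisms

variable {m : ℕ} {r : ℕ∞} {M : Type*} [TopologicalSpace M]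
  [ChartedSpace (EuclideanSpace ℝ (Fin m)) M] {G : Subgroup (Diff m r M)}

noncomputable instance : MulAction (Diff m r M) M where
  smul g x := g x
  one_smul _ := rfl
  mul_smul _ _ _ := rfl

instance : FaithfulSMul (Diff m r M) M := ⟨fun h => Diffeomorph.ext h⟩

instance : ContinuousConstSMul (Diff m r M) M := ⟨fun g => g.continuous⟩

theorem Factorizable.fragmentable (hG : Factorizable G) : Fragmentable G M := by
  intro 𝒰 hUo hUc
  rw [← (Subgroup.map_injective G.subtype_injective).eq_iff, Subgroup.map_iSup,
    ← MonoidHom.range_eq_map, G.range_subtype]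
  refine le_antisymm (iSup_le fun U => Subgroup.map_subtype_le _) fun g hg => ?_
  obtain ⟨l, rfl, hl⟩ := hG 𝒰 hUo hUc g hg
  refine list_prod_mem fun h hh => ?_
  obtain ⟨U, hU, f, -, hf, rfl⟩ := hl h hh
  obtain ⟨hfG, -, hsupp⟩ := hf 1
  refine Subgroup.mem_iSup_of_mem ⟨U, hU⟩ ⟨⟨f 1, hfG⟩, mem_rigidStabilizer.2 fun x hx => ?_, rfl⟩
  exact not_not.1 fun hne => hx (hsupp (subset_closure hne))

theorem IsIsotopy.mul {f g : ℝ → Diff m r M} (hf : IsIsotopy f) (hg : IsIsotopy g) :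
    IsIsotopy fun t => f t * g t :=
  ⟨hf.1.comp (contMDiff_fst.prodMk hg.1), by simp only [hf.2, hg.2, mul_one]⟩

theorem isIsotopy_one : IsIsotopy fun _ : ℝ => (1 : Diff m r M) :=
  ⟨contMDiff_snd, rfl⟩

/-- An isotopy, regarded as an arrow with domain all of `ℝ × M`. -/
noncomputable def IsIsotopy.toArrow {f : ℝ → Diff m r M} (hf : IsIsotopy f) : Arrow m r M where
  dom := univ
  toFun t x := f t x
  isOpen_dom := isOpen_univ
  contMDiffOn := hf.1.contMDiffOn
  localDiffeo t := ⟨(f t).toPartialDiffeomorph, rfl, fun _ _ => rfl⟩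
  zero x _ := DFunLike.congr_fun hf.2 x
  antitone _ _ _ _ _ _ := mem_univ _

theorem foliation_eq_orbitRel (hG : IsotopicallyConnected G) :
    foliation G = orbitRel G M := by
  refine le_antisymm (Setoid.eqvGen_le ?_) fun x y hxy => ?_
  · rintro x _ ⟨φ, ⟨f, -, hfG, hφ⟩, t, hx, rfl⟩
    exact (orbitRel G M).symm ⟨⟨f t, hfG t⟩, (hφ (t, x) hx).symm⟩
  · obtain ⟨⟨g, hg⟩, rfl⟩ := hxy
    obtain ⟨f, hf, hfG, rfl⟩ := hG g hg
    exact (foliation G).symm <| Relation.EqvGen.rel _ _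
      ⟨hf.toArrow, ⟨f, hf, hfG, fun _ _ => rfl⟩, 1, mem_univ _, rfl⟩

variable [IsManifold (𝓡 m) r M]

theorem IsIsotopy.inv (hr : 1 ≤ r) {f : ℝ → Diff m r M} (hf : IsIsotopy f) :
    IsIsotopy fun t => (f t)⁻¹ :=
  ⟨contMDiff_symm_family (mod_cast (zero_lt_one.trans_le hr).ne') hf.1,
    by simp only [hf.2, inv_one]⟩

/-- The identity component of `G`, in the sense of isotopies in `G`, as a subgroup. -/
def identityComponentSubgroup (hr : 1 ≤ r) (G : Subgroup (Diff m r M)) :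
    Subgroup (Diff m r M) where
  carrier := identityComponent (G : Set (Diff m r M))
  mul_mem' := by
    rintro _ _ ⟨f, hf, hfG, rfl⟩ ⟨g, hg, hgG, rfl⟩
    exact ⟨_, hf.mul hg, fun t => mul_mem (hfG t) (hgG t), rfl⟩
  one_mem' := ⟨_, isIsotopy_one, fun _ => one_mem G, rfl⟩
  inv_mem' := by
    rintro _ ⟨f, hf, hfG, rfl⟩
    exact ⟨_, hf.inv hr, fun t => inv_mem (hfG t), rfl⟩

theorem IsotopicallyConnected.commutator (hr : 1 ≤ r) (hG : IsotopicallyConnected G) :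
    IsotopicallyConnected ⁅G, G⁆ := by
  change ⁅G, G⁆ ≤ identityComponentSubgroup hr ⁅G, G⁆
  refine Subgroup.commutator_le.2 fun a ha b hb => ?_
  obtain ⟨f, hf, hfG, rfl⟩ := hG a ha
  obtain ⟨g, hg, hgG, rfl⟩ := hG b hb
  exact ⟨fun t => ⁅f t, g t⁆, ((hf.mul hg).mul (hf.inv hr)).mul (hg.inv hr),
    fun t => Subgroup.commutator_mem_commutator (hfG t) (hgG t), rfl⟩

end Diffeomorphisms

end DiffGroups

open DiffGroups in
theorem theorem1p1_general {m : ℕ} {M : Type*} [TopologicalSpace M] [T2Space M]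
    [ParacompactSpace M] [Nonempty M] [ChartedSpace (EuclideanSpace ℝ (Fin m)) M]
    (r : ℕ∞) [IsManifold (𝓡 m) r M] (hr : 1 ≤ r) (G : Subgroup (Diff m r M))
    (hconn : IsotopicallyConnected G) (hfix : NonFixing G) (hfrag : Fragmentable G M) :
    (IsSimpleGroup ↥⁅G, G⁆ ↔ AllLeavesDense (foliation ⁅G, G⁆)) ∧
    (IsSimpleGroup ↥⁅G, G⁆ → NoProperMinimalSet (foliation ⁅G, G⁆)) ∧
    (CompactSpace M → (IsSimpleGroup ↥⁅G, G⁆ ↔ NoProperMinimalSet (foliation ⁅G, G⁆))) := by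
  rw [foliation_eq_orbitRel (hconn.commutator hr)]
  have hsimple := isSimpleGroup_commutator_iff_isMinimal hfrag hfix
  have hdense := hsimple.trans allLeavesDense_orbitRel_iff.symm
  have hminimal := fun h => (hdense.1 h).noProperMinimalSet
  exact ⟨hdense, hminimal, fun _ => ⟨hminimal, fun h => hsimple.2 h.isMinimal⟩⟩

theorem theorem1p1 {m : ℕ} {M : Type*} [TopologicalSpace M] [T2Space M] [ParacompactSpace M]
    [Nonempty M] [ChartedSpace (EuclideanSpace ℝ (Fin m)) M] [IsManifold (𝓡 m) ∞ M]
    (r : ℕ∞) (hr : 1 ≤ r) (G : Subgroup (DiffGroups.Diff m r M))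
    (hG : (G : Set (DiffGroups.Diff m r M)) ⊆ DiffGroups.diffCompactZero m r M)
    (hconn : DiffGroups.IsotopicallyConnected G) (hfix : DiffGroups.NonFixing G)
    (hfact : DiffGroups.Factorizable G) :
    (IsSimpleGroup ↥⁅G, G⁆ ↔ DiffGroups.AllLeavesDense (DiffGroups.foliation ⁅G, G⁆)) ∧
    (IsSimpleGroup ↥⁅G, G⁆ → DiffGroups.NoProperMinimalSet (DiffGroups.foliation ⁅G, G⁆)) ∧
    (CompactSpace M →
      (IsSimpleGroup ↥⁅G, G⁆ ↔
        DiffGroups.NoProperMinimalSet (DiffGroups.foliation ⁅G, G⁆))) :=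
  have : IsManifold (𝓡 m) r M := .of_le (n := ∞) (mod_cast le_top)
  theorem1p1_general r hr G hconn hfix hfact.fragmentable
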